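/- **Theorem 4.2.** Let $\Gamma\subseteq\mathrm{PSL}_2(\mathbb{R})$ be a Fuchsian group (a discrete subgroup), acting on the upper half-plane $\mathbb{H}=\{z=x+iy : y>0\}$ by fractional linear transformations, and let $M=\Gamma\backslash\mathbb{H}$ be the quotient space. For an integer $k\ge 1$, let $\mathcal{S}_{2k}^{\Gamma}$ be the space of cusp forms of weight $2k$ for $\Gamma$, i.e. of holomorphic functions $f:\mathbb{H}\to\mathbb{C}$ with $f(\gamma z)=(cz+d)^{2k}f(z)$ for all $\gamma=\pm\begin{pmatrix}a&b\\c&d\end{pmatrix}\in\Gamma$ that vanish at all cusps of $\Gamma$, which have finite norm with respect to the Petersson inner product $$\langle f,g\rangle=\int_M f(z)\,\overline{g(z)}\,y^{2k}\,\frac{dx\,dy}{y^2}.$$ (If $\Gamma$ is of the first kind, i.e. if $M$ has finite hyperbolic area, all cusp forms have finite norm and $\mathcal{S}_{2k}^{\Gamma}$ is finite-dimensional.) Let $(f_j)_j$ be an orthonormal basis of the Hilbert space $\mathcal{S}_{2k}^{\Gamma}$ and put $$S_k^{\Gamma}(z)=\sum_j|f_j(z)|^2\,y^{2k},$$ a $\Gamma$-invariant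 function of $z\in\mathbb{H}$ and hence a function on $M$. Then for every Fuchsian group $\Gamma$ and every compact subset $K\subseteq M$ there is a constant $C\ge 0$, depending only on $\Gamma$ and $K$, such that for all integers $k\ge 1$ $$\sup_{z\in K}S_k^{\Gamma}(z)\le C\,k .$$ -/

import Mathlib

open MeasureTheory UpperHalfPlane
open scoped MatrixGroups Pointwise Topology NNReal ENNReal ComplexConjugate

namespace Fuchsian

/-- The action of `PSL(2, ℝ)` on the upper half-plane by fractional linear transformations, as a
homomorphism to permutations of `ℍ`; it is induced by the action of `SL(2, ℝ)`. -/
noncomputable def toPermHom : PSL(2, ℝ) →* Equiv.Perm ℍ :=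
  QuotientGroup.lift (Subgroup.center SL(2, ℝ)) (MulAction.toPermHom SL(2, ℝ) ℍ) (by
    intro g hg
    ext z : 1
    obtain ⟨r, hr, hg⟩ := Matrix.SpecialLinearGroup.mem_center_iff.mp hg
    have hr0 : (r : ℂ) ≠ 0 := by
      rintro h
      simp only [Complex.ofReal_eq_zero] at h
      simp [h] at hr
    have h00 : g 0 0 = r := by rw [← hg]; simp
    have h01 : g 0 1 = 0 := by rw [← hg]; simp
    have h10 : g 1 0 = 0 := by rw [← hg]; simp
    have h11 : g 1 1 = r := by rw [← hg]; simp
    change g • z = z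
    ext
    rw [coe_specialLinearGroup_apply, h00, h01, h10, h11]
    simp [hr0])

/-- `PSL(2, ℝ)` acts on the upper half-plane by fractional linear transformations. -/
noncomputable instance : MulAction PSL(2, ℝ) ℍ := MulAction.compHom ℍ toPermHom

theorem mk_smul (g : SL(2, ℝ)) (z : ℍ) : (QuotientGroup.mk g : PSL(2, ℝ)) • z = g • z := rfl

/-- The quotient space `M = Γ \ ℍ`, with the quotient topology. -/
abbrev QuotientSpace (Γ : Subgroup PSL(2, ℝ)) : Type := Quotient (MulAction.orbitRel Γ ℍ)

/-- The group of all real matrices of determinant one that represent an element of `Γ`. -/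
noncomputable abbrev matrixGroup (Γ : Subgroup PSL(2, ℝ)) : Subgroup (GL (Fin 2) ℝ) :=
  (Γ.comap (QuotientGroup.mk' (Subgroup.center SL(2, ℝ)))).map
    (Matrix.SpecialLinearGroup.mapGL ℝ)

/-- A discrete subgroup of `PSL(2, ℝ)` has a discrete preimage in `SL(2, ℝ)`. -/
theorem discreteTopology_comap (Γ : Subgroup PSL(2, ℝ)) [DiscreteTopology Γ] :
    DiscreteTopology (Γ.comap (QuotientGroup.mk' (Subgroup.center SL(2, ℝ)))) := by
  have : Finite (Subgroup.center SL(2, ℝ)) :=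
    Finite.of_equiv _ (Matrix.SpecialLinearGroup.center_equiv_rootsOfUnity'
      (R := ℝ) (0 : Fin 2)).symm.toEquiv
  have hfin : (Subgroup.center SL(2, ℝ) : Set SL(2, ℝ)).Finite := Set.toFinite _
  obtain ⟨U, hU, hU1⟩ := isOpen_induced_iff.mp (isOpen_discrete ({1} : Set Γ))
  refine discreteTopology_of_isOpen_singleton_one (isOpen_induced_iff.mpr
    ⟨(QuotientGroup.mk ⁻¹' U) ∩ ((Subgroup.center SL(2, ℝ) : Set SL(2, ℝ)) \ {1})ᶜ,
      (hU.preimage QuotientGroup.continuous_mk).inter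
        (hfin.subset Set.sdiff_subset).isClosed.isOpen_compl, ?_⟩)
  ext ⟨g, hg⟩
  have key : (QuotientGroup.mk g : PSL(2, ℝ)) ∈ U ↔ g ∈ Subgroup.center SL(2, ℝ) := by
    have := Set.ext_iff.mp hU1 ⟨QuotientGroup.mk g, hg⟩
    simp only [Set.mem_preimage, Set.mem_singleton_iff, Subtype.ext_iff] at this
    rw [this]
    exact QuotientGroup.eq_one_iff g
  simp only [Set.mem_preimage, Set.mem_inter_iff, key, Set.mem_compl_iff, Set.mem_sdiff,
    Set.mem_singleton_iff, SetLike.mem_coe, Subtype.ext_iff, OneMemClass.coe_one]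
  constructor
  · tauto
  · rintro rfl
    exact ⟨one_mem _, by simp⟩

theorem exists_representative (Γ : Subgroup PSL(2, ℝ)) (γ : Γ) :
    ∃ g : Γ.comap (QuotientGroup.mk' (Subgroup.center SL(2, ℝ))),
      (QuotientGroup.mk (g : SL(2, ℝ)) : PSL(2, ℝ)) = γ := by
  obtain ⟨g, hg⟩ := QuotientGroup.mk_surjective (γ : PSL(2, ℝ))
  exact ⟨⟨g, show (QuotientGroup.mk g : PSL(2, ℝ)) ∈ Γ from hg ▸ γ.2⟩, hg⟩

theorem countable_of_discrete (Γ : Subgroup PSL(2, ℝ)) [DiscreteTopology Γ] : Countable Γ := by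
  have := discreteTopology_comap Γ
  have : SecondCountableTopology (Matrix (Fin 2) (Fin 2) ℝ) :=
    inferInstanceAs (SecondCountableTopology (Fin 2 → Fin 2 → ℝ))
  have : SecondCountableTopology SL(2, ℝ) :=
    Matrix.SpecialLinearGroup.isClosedEmbedding_val.isEmbedding.secondCountableTopology
  have : Countable (Γ.comap (QuotientGroup.mk' (Subgroup.center SL(2, ℝ)))) :=
    TopologicalSpace.separableSpace_iff_countable.mp inferInstance
  choose s hs using exists_representative Γ
  refine Function.Injective.countable (f := s) fun a b h => Subtype.ext ?_
  rw [← hs a, ← hs b, h]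

instance (Γ : Subgroup PSL(2, ℝ)) : ContinuousConstSMul Γ ℍ where
  continuous_const_smul γ := by
    obtain ⟨g, hg⟩ := exists_representative Γ γ
    have : (fun z : ℍ => γ • z) = fun z => (g : SL(2, ℝ)) • z := by
      ext1 z
      rw [Subgroup.smul_def, ← hg, mk_smul]
    rw [this]
    exact continuous_const_smul _

instance (Γ : Subgroup PSL(2, ℝ)) : SMulInvariantMeasure Γ ℍ volume where
  measure_preimage_smul γ s hs := by
    obtain ⟨g, hg⟩ := exists_representative Γ γ
    have : (fun z : ℍ => γ • z) =
        fun z => (Matrix.SpecialLinearGroup.mapGL ℝ (g : SL(2, ℝ)) : GL (Fin 2) ℝ) • z := by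
      ext1 z
      rw [Subgroup.smul_def, ← hg, mk_smul]
      rfl
    rw [this]
    exact measure_preimage_smul_of_nullMeasurableSet hs.nullMeasurableSet _

/-- A Fuchsian group acts properly discontinuously on the upper half-plane. -/
instance (Γ : Subgroup PSL(2, ℝ)) [DiscreteTopology Γ] : ProperlyDiscontinuousSMul Γ ℍ where
  finite_disjoint_inter_image {K L} hK hL := by
    have := discreteTopology_comap Γ
    have hfin := ProperlyDiscontinuousSMul.finite_disjoint_inter_image
      (Γ := Γ.comap (QuotientGroup.mk' (Subgroup.center SL(2, ℝ)))) hK hL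
    choose s hs using exists_representative Γ
    refine Set.Finite.of_finite_image (f := s) (hfin.subset ?_) ?_
    · rintro _ ⟨γ, ⟨_, ⟨z, hz, rfl⟩, hzL⟩, rfl⟩
      refine ⟨γ • z, ⟨z, hz, ?_⟩, hzL⟩
      change (s γ : SL(2, ℝ)) • z = γ • z
      rw [Subgroup.smul_def, ← hs γ, mk_smul]
    · intro a _ b _ h
      exact Subtype.ext (by rw [← hs a, ← hs b, h])

/-- A nontrivial element of `PSL(2, ℝ)` fixes at most one point of `ℍ`. -/
theorem fixed_subsingleton (γ : PSL(2, ℝ)) (hγ : γ ≠ 1) : {z : ℍ | γ • z = z}.Subsingleton := by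
  obtain ⟨g, rfl⟩ := QuotientGroup.mk_surjective γ
  intro z hz w hw
  set h : GL (Fin 2) ℝ := Matrix.SpecialLinearGroup.mapGL ℝ g with hh
  have hz' : h • z = z := hz
  have hw' : h • w = w := hw
  have hpos : 0 < h.val.det := by simp [hh]
  have hc : h ∉ Subgroup.center (GL (Fin 2) ℝ) := by
    intro hc
    refine hγ ((QuotientGroup.eq_one_iff g).mpr (Subgroup.mem_center_iff.mpr fun k => ?_))
    apply Matrix.SpecialLinearGroup.mapGL_injective (S := ℝ)
    rw [map_mul, map_mul]
    exact Subgroup.mem_center_iff.mp hc _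
  have hell := isElliptic_of_exists_smul_eq_self hpos hc ⟨z, hz'⟩
  rw [(gl_smul_eq_self_iff_eq_fixedPt hpos hell).mp hz',
    (gl_smul_eq_self_iff_eq_fixedPt hpos hell).mp hw']

theorem volume_of_subsingleton {s : Set ℍ} (hs : s.Subsingleton) : volume s = 0 := by
  rw [volume_eq_lintegral]
  exact setLIntegral_measure_zero _ _ ((hs.image _).measure_zero _)

/-- Every Fuchsian group has a fundamental domain in the upper half-plane. -/
theorem exists_isFundamentalDomain (Γ : Subgroup PSL(2, ℝ)) [DiscreteTopology Γ] :
    ∃ F : Set ℍ, IsFundamentalDomain Γ F volume := by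
  have := countable_of_discrete Γ
  have hU : ∀ z : ℍ, ∃ U : Set ℍ, IsOpen U ∧ z ∈ U ∧
      ∀ γ : Γ, γ • z ≠ z → Disjoint ((γ • ·) '' U) U := by
    intro z
    obtain ⟨V, hV, hd⟩ := ProperlyDiscontinuousSMul.exists_nhds_disjoint_image Γ z
    obtain ⟨U, hUV, hUo, hzU⟩ := mem_nhds_iff.mp hV
    exact ⟨U, hUo, hzU, fun γ hγ => (hd γ hγ).mono (Set.image_mono hUV) hUV⟩
  choose U hUo hzU hUd using hU
  set E : Set ℍ := ⋃ γ : {γ : Γ // γ ≠ 1}, {z : ℍ | (γ : Γ) • z = z} with hE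
  have hE0 : volume E = 0 := measure_iUnion_null fun γ => volume_of_subsingleton
    (fixed_subsingleton _ fun h => γ.2 (Subtype.ext h))
  obtain ⟨T, hTE, hTc, hT⟩ := TopologicalSpace.countable_cover_nhdsWithin (s := Eᶜ)
    (f := U) (fun z _ => mem_nhdsWithin_of_mem_nhds ((hUo z).mem_nhds (hzU z)))
  have := hTc.to_subtype
  obtain ⟨e, he⟩ := exists_injective_nat T
  -- the points of `U t` whose orbit does not meet an earlier set of the cover
  let A : T → Set ℍ := fun t => U t \ ⋃ s : {s : T // e s < e t}, ⋃ γ : Γ, (γ • ·) ⁻¹' U s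
  have hA : ∀ t, MeasurableSet (A t) := fun t =>
    (hUo t).measurableSet.diff (MeasurableSet.iUnion fun s => MeasurableSet.iUnion fun γ =>
      ((hUo s).preimage (continuous_const_smul γ)).measurableSet)
  refine ⟨⋃ t, A t, IsFundamentalDomain.mk'' (MeasurableSet.iUnion hA).nullMeasurableSet ?_ ?_
    fun γ => (measurePreserving_smul γ volume).quasiMeasurePreserving⟩
  · filter_upwards [compl_mem_ae_iff.mpr hE0] with z hz
    have hex : ∃ n, ∃ t : T, e t = n ∧ ∃ γ : Γ, γ • z ∈ U t := by
      obtain ⟨t, ht, hzt⟩ := Set.mem_iUnion₂.mp (hT hz)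
      exact ⟨_, ⟨t, ht⟩, rfl, 1, by simpa using hzt⟩
    classical
    obtain ⟨t, ht, γ, hγ⟩ := Nat.find_spec hex
    refine ⟨γ, Set.mem_iUnion.mpr ⟨t, hγ, fun hmem => ?_⟩⟩
    simp only [Set.mem_iUnion, Set.mem_preimage] at hmem
    obtain ⟨⟨s, hs⟩, δ, hδ⟩ := hmem
    exact Nat.find_min hex (ht ▸ hs) ⟨s, rfl, δ * γ, by rwa [mul_smul]⟩
  · intro γ hγ
    refine Disjoint.aedisjoint (Set.disjoint_left.mpr ?_)
    rintro _ ⟨z, hz, rfl⟩ hγz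
    obtain ⟨t, hzt, hzt'⟩ := Set.mem_iUnion.mp hz
    obtain ⟨s, hzs, hzs'⟩ := Set.mem_iUnion.mp hγz
    simp only [Set.mem_iUnion, Set.mem_preimage, not_exists] at hzt' hzs'
    have hst : s = t := by
      apply he
      apply le_antisymm
      · by_contra! h
        exact hzs' ⟨t, h⟩ γ⁻¹ (by simpa using hzt)
      · by_contra! h
        exact hzt' ⟨s, h⟩ γ hzs
    subst hst
    have hne : γ • (s : ℍ) ≠ s := fun h =>
      hTE s.2 (Set.mem_iUnion.mpr ⟨⟨γ, hγ⟩, h⟩)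
    exact Set.disjoint_left.mp (hUd _ γ hne) ⟨z, hzt, rfl⟩ hzs

/-- A fundamental domain of a Fuchsian group. Integrals over `M = Γ \ ℍ` are integrals over it;
they do not depend on the choice. -/
noncomputable def fundamentalDomain (Γ : Subgroup PSL(2, ℝ)) [DiscreteTopology Γ] : Set ℍ :=
  (exists_isFundamentalDomain Γ).choose

theorem isFundamentalDomain (Γ : Subgroup PSL(2, ℝ)) [DiscreteTopology Γ] :
    IsFundamentalDomain Γ (fundamentalDomain Γ) volume :=
  (exists_isFundamentalDomain Γ).choose_spec

/-- The space of cusp forms of weight `2k` for `Γ`: holomorphic functions `f` on `ℍ` with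
`f (γ z) = (c z + d) ^ (2k) * f z` for `γ ∈ Γ` which vanish at all cusps of `Γ`. -/
abbrev CuspForms (Γ : Subgroup PSL(2, ℝ)) (k : ℕ) : Type := CuspForm (matrixGroup Γ) (2 * k)

section Petersson

variable {Γ : Subgroup PSL(2, ℝ)} {k : ℕ}

/-- The function `|f(z)|² Im(z)^(2k)` is invariant under `Γ`. -/
theorem sq_norm_mul_im_smul (f : CuspForms Γ k) (γ : Γ) (z : ℍ) :
    ‖f (γ • z)‖ ^ 2 * (γ • z).im ^ (2 * k) = ‖f z‖ ^ 2 * z.im ^ (2 * k) := by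
  obtain ⟨g, hg⟩ := exists_representative Γ γ
  have h := SlashInvariantFormClass.norm_petersson_smul (k := 2 * (k : ℤ)) (f := f) (f' := f)
    (τ := z) (Subgroup.mem_map_of_mem (Matrix.SpecialLinearGroup.mapGL ℝ) g.2)
  have hs : (Matrix.SpecialLinearGroup.mapGL ℝ (g : SL(2, ℝ)) : GL (Fin 2) ℝ) • z = γ • z := by
    rw [Subgroup.smul_def, ← hg, mk_smul]
    rfl
  have hp : ∀ w : ℍ, ‖petersson (2 * (k : ℤ)) f f w‖ = ‖f w‖ ^ 2 * w.im ^ (2 * k) := by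
    intro w
    have : (w.im : ℂ) ^ (2 * (k : ℤ)) = (w.im : ℂ) ^ (2 * k) := by
      rw [← zpow_natCast]
      push_cast
      rfl
    rw [petersson, this]
    simp [sq, abs_of_pos w.im_pos]
  rwa [hs, hp, hp] at h

/-- The Petersson inner product `⟨f, g⟩ = ∫_M f(z) conj(g(z)) y^(2k) dμ(z)` with respect to the
hyperbolic measure `dμ = dx dy / y²`, which is the volume on `ℍ`. -/
noncomputable def peterssonInner [DiscreteTopology Γ] (f g : CuspForms Γ k) : ℂ :=
  ∫ z in fundamentalDomain Γ, f z * conj (g z) * (z.im : ℂ) ^ (2 * k)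

/-- The cusp form `f` has finite Petersson norm. -/
def SquareIntegrable [DiscreteTopology Γ] (f : CuspForms Γ k) : Prop :=
  IntegrableOn (fun z : ℍ => ‖f z‖ ^ 2 * z.im ^ (2 * k)) (fundamentalDomain Γ)

/-- The family `f` is an orthonormal basis of the Hilbert space of cusp forms of weight `2k` of
finite Petersson norm: it is orthonormal, and only `0` is orthogonal to all its members. -/
structure IsOrthonormalBasis [DiscreteTopology Γ] {ι : Type*} (f : ι → CuspForms Γ k) : Prop where
  squareIntegrable : ∀ j, SquareIntegrable (f j)
  inner_self : ∀ j, peterssonInner (f j) (f j) = 1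
  inner_of_ne : ∀ i j, i ≠ j → peterssonInner (f i) (f j) = 0
  total : ∀ g : CuspForms Γ k, SquareIntegrable g → (∀ j, peterssonInner g (f j) = 0) → g = 0

/-- The function `S(z) = ∑ⱼ |fⱼ(z)|² Im(z)^(2k)` on `M = Γ \ ℍ`, with values in `[0, ∞]`. -/
noncomputable def sumSq {ι : Type*} (f : ι → CuspForms Γ k) : QuotientSpace Γ → ℝ≥0∞ :=
  Quotient.lift (fun z : ℍ => ∑' j, ENNReal.ofReal (‖f j z‖ ^ 2 * z.im ^ (2 * k))) (by
    rintro _ z ⟨γ, rfl⟩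
    exact tsum_congr fun j => congrArg ENNReal.ofReal (sq_norm_mul_im_smul (f j) γ z))

end Petersson

end Fuchsian

namespace Fuchsian

/-! The bound is a reproducing-kernel argument. Fix `z` and finitely many members of the basis, and
put `g = ∑ conj (f j z) • f j` and `s = ∑ ‖f j z‖ ^ 2`. Then `g z = s`, and by orthonormality `g`
has squared Petersson norm `s`. If `‖g z‖² y^(2k)` is at most `9 N k` times that squared norm, then
`s² y^(2k) ≤ 9 N k s`, and dividing by `s` bounds the partial sum (`IsOrthonormalBasis.tsum_le`).

The pointwise bound has two sources. The factor `k` is local (`ofReal_sq_norm_mul_im_pow_le`): after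
multiplication by a suitable exponential, `‖g‖² Im^(2k)` is comparable with the norm of a
holomorphic function on a disc of radius of order `y / √k`. The sub-mean value property applies
there, and the hyperbolic area of the disc is of order `1 / k`. The factor `N` is global
(`exists_setLIntegral_le_fundamentalDomain`): by proper discontinuity a compact set covers almost
every orbit a bounded number of times, independently of the weight. Compactness of `K` then leaves
finitely many values of `N`. -/

/-! ### Mean values of holomorphic functions over circles and discs. -/

theorem enorm_mul_two_pi_le_lintegral_rotation {f : ℂ → ℂ} {c w : ℂ} {R : ℝ}
    (hf : DifferentiableOn ℂ f (Metric.ball c R)) (hw : w ∈ Metric.ball (0 : ℂ) R) :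
    ‖f c‖ₑ * ENNReal.ofReal (2 * Real.pi) ≤
      ∫⁻ θ in Set.Ioc 0 (2 * Real.pi), ‖f (c + circleMap 0 1 θ * w)‖ₑ := by
  have hmaps : Set.MapsTo (fun z : ℂ => c + z * w) (Metric.closedBall 0 1) (Metric.ball c R) := by
    intro z hz
    rw [mem_closedBall_zero_iff] at hz
    rw [mem_ball_zero_iff] at hw
    rw [Metric.mem_ball, dist_self_add_left, norm_mul]
    nlinarith [norm_nonneg z, norm_nonneg w]
  have hd : DiffContOnCl ℂ (fun z : ℂ => f (c + z * w)) (Metric.ball 0 |1|) := by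
    rw [abs_one]
    refine DifferentiableOn.diffContOnCl_ball (U := Metric.closedBall 0 1) ?_ le_rfl
    exact hf.comp (by fun_prop) hmaps
  have h := hd.circleAverage
  rw [Real.circleAverage_def, intervalIntegral.integral_of_le Real.two_pi_pos.le] at h
  have hpi : (2 * Real.pi) ≠ 0 := Real.two_pi_pos.ne'
  have h2 : (∫ θ in Set.Ioc 0 (2 * Real.pi), f (c + circleMap 0 1 θ * w)) =
      (2 * Real.pi) • f c := by
    rw [inv_smul_eq_iff₀ hpi] at h
    simpa using h
  calc ‖f c‖ₑ * ENNReal.ofReal (2 * Real.pi) = ‖(2 * Real.pi) • f c‖ₑ := by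
        rw [enorm_smul, Real.enorm_of_nonneg Real.two_pi_pos.le, mul_comm]
    _ ≤ _ := by
        rw [← h2]
        exact enorm_integral_le_lintegral_enorm _

/-- The sub-mean value property of holomorphic functions on discs. -/
theorem enorm_mul_volume_ball_le_lintegral {f : ℂ → ℂ} {c : ℂ} {R : ℝ}
    (hf : DifferentiableOn ℂ f (Metric.ball c R)) :
    ‖f c‖ₑ * volume (Metric.ball c R) ≤ ∫⁻ z in Metric.ball c R, ‖f z‖ₑ := by
  -- Extended by zero, `‖f‖ₑ` has the same integral after every rotation about `c`. Averaging over
  -- rotations and exchanging integrals reduces the disc to circles, without polar coordinates.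
  set G : ℂ → ℝ≥0∞ := (Metric.ball c R).indicator fun z => ‖f z‖ₑ with hG
  have hGm : Measurable G := by
    classical
    rw [hG, ← Set.piecewise_eq_indicator]
    exact ContinuousOn.measurable_piecewise hf.continuousOn.enorm continuousOn_const
      measurableSet_ball
  have hrot : ∀ θ : ℝ, ∫⁻ w, G (c + circleMap 0 1 θ * w) = ∫⁻ z, G z := by
    intro θ
    have hm : MeasurePreserving (fun w : ℂ => circleMap 0 1 θ * w) := by
      convert (rotation (Circle.exp θ)).measurePreserving using 2 with w
      simp [circleMap]
    rw [← lintegral_add_left_eq_self G c]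
    exact hm.lintegral_comp (f := fun w => G (c + w)) (by fun_prop)
  have h2pi : ENNReal.ofReal (2 * Real.pi) ≠ 0 := by simp [Real.pi_pos]
  refine (ENNReal.mul_le_mul_iff_left h2pi ENNReal.ofReal_ne_top).mp ?_
  calc ‖f c‖ₑ * volume (Metric.ball c R) * ENNReal.ofReal (2 * Real.pi)
      = ∫⁻ w in Metric.ball (0 : ℂ) R, ‖f c‖ₑ * ENNReal.ofReal (2 * Real.pi) := by
        rw [setLIntegral_const, Complex.volume_ball, Complex.volume_ball]
        ring
    _ ≤ ∫⁻ w in Metric.ball (0 : ℂ) R,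
          ∫⁻ θ in Set.Ioc 0 (2 * Real.pi), G (c + circleMap 0 1 θ * w) := by
        refine setLIntegral_mono' measurableSet_ball fun w hw => ?_
        refine (enorm_mul_two_pi_le_lintegral_rotation hf hw).trans_eq ?_
        refine lintegral_congr fun θ => ?_
        rw [hG, Set.indicator_of_mem]
        simpa using hw
    _ ≤ ∫⁻ w, ∫⁻ θ in Set.Ioc 0 (2 * Real.pi), G (c + circleMap 0 1 θ * w) :=
        setLIntegral_le_lintegral _ _
    _ = ∫⁻ θ in Set.Ioc 0 (2 * Real.pi), ∫⁻ w, G (c + circleMap 0 1 θ * w) := by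
        refine lintegral_lintegral_swap (Measurable.aemeasurable ?_)
        have : Continuous fun p : ℂ × ℝ => c + circleMap 0 1 p.2 * p.1 := by fun_prop
        exact hGm.comp this.measurable
    _ = (∫⁻ z in Metric.ball c R, ‖f z‖ₑ) * ENNReal.ofReal (2 * Real.pi) := by
        simp_rw [hrot]
        rw [setLIntegral_const, Real.volume_Ioc, sub_zero, hG,
          lintegral_indicator measurableSet_ball]

/-! ### Local bound with a constant linear in the weight. -/

theorem exp_sub_le_one_add {u : ℝ} (hu : |u| ≤ 1 / 2) : Real.exp (u - 2 * u ^ 2) ≤ 1 + u := by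
  obtain ⟨h1, h2⟩ := abs_le.mp hu
  have h0 : 0 < 1 + u := by linarith
  -- In logarithmic form: `u - 2u² ≤ u / (1 + u) ≤ log (1 + u)`.
  have h3 : u - 2 * u ^ 2 ≤ u / (1 + u) := by
    rw [le_div_iff₀ h0]
    nlinarith [mul_nonneg (sq_nonneg u) (by linarith : 0 ≤ 1 + 2 * u)]
  have h4 : (1 + u)⁻¹ ≤ Real.exp (-(u / (1 + u))) := by
    refine le_trans (le_of_eq ?_) (Real.add_one_le_exp _)
    field_simp
    ring
  rw [Real.exp_neg, inv_le_inv₀ h0 (Real.exp_pos _)] at h4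
  exact (Real.exp_le_exp.mpr h3).trans h4

/-- Near `1` the power `(1 + u) ^ (2 k)` is comparable with `exp (2 k u)`, uniformly for
`|u| ≤ 1 / (2 √k)`. -/
theorem exp_mul_sq_le {k : ℕ} (hk : 0 < k) {u : ℝ} (hu : u ^ 2 * (4 * k) ≤ 1) :
    Real.exp (2 * k * u) * (1 + u) ^ 2 ≤ 27 / 4 * (1 + u) ^ (2 * k) := by
  have hk1 : (1 : ℝ) ≤ k := by exact_mod_cast hk
  have hu2 : |u| ≤ 1 / 2 := abs_le_of_sq_le_sq (by nlinarith [sq_nonneg u]) (by norm_num)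
  have h1 := exp_sub_le_one_add hu2
  obtain ⟨h2, h3⟩ := abs_le.mp hu2
  -- The quadratic error `2k · 2u²` is at most `1`, which costs a factor `e < 3`. The other factor,
  -- `9 / 4 = (3 / 2)²`, bounds `(1 + u)²`, which comes from the hyperbolic density.
  have h4 : Real.exp (2 * k * u) ≤ 3 * (1 + u) ^ (2 * k) :=
    calc Real.exp (2 * k * u) ≤ Real.exp (1 + (2 * k : ℕ) * (u - 2 * u ^ 2)) := by
          refine Real.exp_le_exp.mpr ?_
          push_cast
          nlinarith
      _ = Real.exp 1 * Real.exp (u - 2 * u ^ 2) ^ (2 * k) := by rw [Real.exp_add, Real.exp_nat_mul]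
      _ ≤ 3 * (1 + u) ^ (2 * k) := by
          gcongr
          exact Real.exp_one_lt_three.le
  have h5 : (1 + u) ^ 2 ≤ 9 / 4 := by nlinarith
  calc _ ≤ 3 * (1 + u) ^ (2 * k) * (9 / 4) := by
        have h6 : 0 ≤ 1 + u := by linarith
        gcongr
    _ = _ := by ring

/-- The hyperbolic measure is Lebesgue measure with density `1 / y²`. Measurability of `φ` is
avoided because the inclusion is a measurable embedding and the density is finite. -/
theorem setLIntegral_eq_setLIntegral_complex (φ : ℍ → ℝ≥0∞) {s : Set ℂ} (hs : MeasurableSet s)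
    (hpos : ∀ z ∈ s, 0 < z.im) :
    ∫⁻ z in ((↑) : ℍ → ℂ) ⁻¹' s, φ z =
      ∫⁻ z in s, ENNReal.ofReal (1 / z.im ^ 2) * φ (ofComplex z) := by
  have hpre : MeasurableSet (((↑) : ℍ → ℂ) ⁻¹' s) := measurable_coe hs
  have himg : ((↑) : ℍ → ℂ) '' (((↑) : ℍ → ℂ) ⁻¹' s) = s := by
    rw [Set.image_preimage_eq_iff]
    exact fun z hz => ⟨⟨z, hpos z hz⟩, rfl⟩
  have hmp : MeasurePreserving ((↑) : ℍ → ℂ) (volume.comap ((↑) : ℍ → ℂ))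
      (volume.restrict (Set.range ((↑) : ℍ → ℂ))) :=
    ⟨measurable_coe, by rw [measurableEmbedding_coe.map_comap]⟩
  have hm : Measurable fun z : ℍ => ((1 / NNReal.mk z.im z.im_pos.le : ℝ≥0) ^ 2) := by
    have : Continuous fun z : ℍ => (NNReal.mk z.im z.im_pos.le : ℝ≥0) :=
      continuous_im.subtype_mk _
    exact (measurable_const.div this.measurable).pow_const _
  have hc := hmp.setLIntegral_comp_emb measurableEmbedding_coe
    (fun z : ℂ => ENNReal.ofReal (1 / z.im ^ 2) * φ (ofComplex z)) (((↑) : ℍ → ℂ) ⁻¹' s)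
  rw [himg, Measure.restrict_restrict hs, Set.inter_eq_self_of_subset_left
    (Set.image_preimage_eq_iff.mp himg)] at hc
  rw [volume_def, setLIntegral_withDensity_eq_setLIntegral_mul_non_measurable _
    hm.coe_nnreal_ennreal _ hpre (by simp), ← hc]
  refine lintegral_congr fun z => ?_
  rw [ofComplex_apply, Pi.mul_apply]
  congr 1
  rw [ENNReal.ofReal, ENNReal.coe_inj]
  ext
  rw [Real.coe_toNNReal _ (by positivity)]
  simp

/-- The value of a holomorphic function at `z₀` is bounded by the mean of
`‖g z‖ ^ 2 * Im z ^ (2 * k)` over a disc around `z₀`, with a constant linear in the weight. -/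
theorem ofReal_sq_norm_mul_im_pow_le {g : ℍ → ℂ}
    (hg : DifferentiableOn ℂ (g ∘ ofComplex) {z | 0 < z.im}) (z₀ : ℍ) {k : ℕ} (hk : 0 < k) :
    ENNReal.ofReal (‖g z₀‖ ^ 2 * z₀.im ^ (2 * k)) ≤
      9 * k * ∫⁻ z in ((↑) : ℍ → ℂ) ⁻¹' Metric.ball (z₀ : ℂ) (z₀.im / 2),
        ENNReal.ofReal (‖g z‖ ^ 2 * z.im ^ (2 * k)) := by
  have hk1 : (1 : ℝ) ≤ k := by exact_mod_cast hk
  have hy : 0 < z₀.im := z₀.im_pos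
  set y : ℝ := z₀.im with hy_def
  set r : ℝ := y / (2 * √k) with hr_def
  have hsqrt : 1 ≤ √(k : ℝ) := Real.one_le_sqrt.mpr hk1
  have hr : 0 < r := by positivity
  have hr2 : r ^ 2 * (4 * k) = y ^ 2 := by
    rw [hr_def, div_pow, mul_pow, Real.sq_sqrt (by positivity)]
    field_simp
    norm_num
  have hry : r ≤ y / 2 := by
    rw [hr_def]
    gcongr
    linarith
  have him : ∀ z ∈ Metric.ball (z₀ : ℂ) r, |z.im - y| < r := fun z hz => by
    refine lt_of_le_of_lt ?_ (mem_ball_iff_norm.mp hz)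
    simpa using Complex.abs_im_le_norm (z - z₀)
  have hpos : ∀ z ∈ Metric.ball (z₀ : ℂ) r, 0 < z.im := fun z hz => by
    have := (abs_lt.mp (him z hz)).1
    linarith
  -- The exponential contributes `exp (2k (Im z - y) / y)` to `‖G z‖`, which agrees with `(Im z /
  -- y)^(2k)` to first order at `z₀`. The radius `y / (2√k)` keeps the second-order error bounded.
  set G : ℂ → ℂ := fun z =>
    (g (ofComplex z) * Complex.exp (-Complex.I * (k / y : ℝ) * (z - z₀))) ^ 2 with hG
  have hGd : DifferentiableOn ℂ G (Metric.ball (z₀ : ℂ) r) := by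
    have h1 : DifferentiableOn ℂ (fun z => g (ofComplex z)) (Metric.ball (z₀ : ℂ) r) :=
      hg.mono hpos
    exact (h1.mul (by fun_prop)).pow 2
  have hGn : ∀ z, ‖G z‖ = ‖g (ofComplex z)‖ ^ 2 * Real.exp (2 * k * ((z.im - y) / y)) := by
    intro z
    rw [hG, norm_pow, norm_mul, mul_pow, Complex.norm_exp, ← Real.exp_nat_mul]
    congr 2
    simp
    ring
  have hpt : ∀ z ∈ Metric.ball (z₀ : ℂ) r, ENNReal.ofReal (y ^ (2 * k)) * ‖G z‖ₑ ≤
      ENNReal.ofReal (27 / 4 * y ^ 2) * (ENNReal.ofReal (1 / z.im ^ 2) *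
        ENNReal.ofReal (‖g (ofComplex z)‖ ^ 2 * (ofComplex z).im ^ (2 * k))) := by
    intro z hz
    have hz0 := hpos z hz
    have hzim : (ofComplex z).im = z.im := by
      rw [ofComplex_apply_of_im_pos hz0]
      rfl
    rw [hzim, ← ofReal_norm, hGn, ← ENNReal.ofReal_mul (by positivity),
      ← ENNReal.ofReal_mul (by positivity), ← ENNReal.ofReal_mul (by positivity)]
    refine ENNReal.ofReal_le_ofReal ?_
    set u : ℝ := (z.im - y) / y with hu
    have hzu : z.im = y * (1 + u) := by
      rw [hu]
      field_simp
      ring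
    have hu1 : u ^ 2 * (4 * k) ≤ 1 := by
      have h1 : (z.im - y) ^ 2 ≤ r ^ 2 := sq_le_sq' (abs_lt.mp (him z hz)).1.le
        (abs_lt.mp (him z hz)).2.le
      rw [hu, div_pow, div_mul_eq_mul_div, div_le_one (by positivity), ← hr2]
      gcongr
    have h1u : 0 < 1 + u := by
      rw [hzu] at hz0
      exact pos_of_mul_pos_right hz0 hy.le
    have key := exp_mul_sq_le hk hu1
    rw [← le_div_iff₀ (by positivity)] at key
    calc y ^ (2 * k) * (‖g (ofComplex z)‖ ^ 2 * Real.exp (2 * k * u))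
        ≤ y ^ (2 * k) * (‖g (ofComplex z)‖ ^ 2 * (27 / 4 * (1 + u) ^ (2 * k) / (1 + u) ^ 2)) := by
          gcongr
      _ = 27 / 4 * y ^ 2 * (1 / z.im ^ 2 * (‖g (ofComplex z)‖ ^ 2 * z.im ^ (2 * k))) := by
          rw [hzu, mul_pow, mul_pow]
          field_simp
  set J := ∫⁻ z in ((↑) : ℍ → ℂ) ⁻¹' Metric.ball (z₀ : ℂ) (y / 2),
    ENNReal.ofReal (‖g z‖ ^ 2 * z.im ^ (2 * k)) with hJ
  have hV : volume (Metric.ball (z₀ : ℂ) r) = ENNReal.ofReal (r ^ 2 * Real.pi) := by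
    rw [Complex.volume_ball, ENNReal.ofReal_mul (by positivity), ENNReal.ofReal_pow hr.le]
    congr 1
    exact (ENNReal.ofReal_coe_nnreal (p := NNReal.pi)).symm
  have hV0 : volume (Metric.ball (z₀ : ℂ) r) ≠ 0 := by
    rw [hV, ENNReal.ofReal_ne_zero_iff]
    positivity
  have hVt : volume (Metric.ball (z₀ : ℂ) r) ≠ ⊤ := hV ▸ ENNReal.ofReal_ne_top
  refine (ENNReal.mul_le_mul_iff_left hV0 hVt).mp ?_
  have hG0 : ‖G z₀‖ₑ = ENNReal.ofReal (‖g z₀‖ ^ 2) := by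
    rw [← ofReal_norm, hGn, ofComplex_apply]
    simp [hy_def]
  calc ENNReal.ofReal (‖g z₀‖ ^ 2 * y ^ (2 * k)) * volume (Metric.ball (z₀ : ℂ) r)
      = ENNReal.ofReal (y ^ (2 * k)) * (‖G z₀‖ₑ * volume (Metric.ball (z₀ : ℂ) r)) := by
        rw [hG0, ENNReal.ofReal_mul (by positivity)]
        ring
    _ ≤ ENNReal.ofReal (y ^ (2 * k)) * ∫⁻ z in Metric.ball (z₀ : ℂ) r, ‖G z‖ₑ := by
        gcongr
        exact enorm_mul_volume_ball_le_lintegral hGd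
    _ = ∫⁻ z in Metric.ball (z₀ : ℂ) r, ENNReal.ofReal (y ^ (2 * k)) * ‖G z‖ₑ :=
        (lintegral_const_mul' _ _ ENNReal.ofReal_ne_top).symm
    _ ≤ ∫⁻ z in Metric.ball (z₀ : ℂ) r, ENNReal.ofReal (27 / 4 * y ^ 2) *
          (ENNReal.ofReal (1 / z.im ^ 2) *
            ENNReal.ofReal (‖g (ofComplex z)‖ ^ 2 * (ofComplex z).im ^ (2 * k))) :=
        setLIntegral_mono' measurableSet_ball hpt
    _ = ENNReal.ofReal (27 / 4 * y ^ 2) * ∫⁻ z in ((↑) : ℍ → ℂ) ⁻¹' Metric.ball (z₀ : ℂ) r,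
          ENNReal.ofReal (‖g z‖ ^ 2 * z.im ^ (2 * k)) := by
        rw [lintegral_const_mul' _ _ ENNReal.ofReal_ne_top,
          setLIntegral_eq_setLIntegral_complex _ measurableSet_ball hpos]
    _ ≤ ENNReal.ofReal (27 / 4 * y ^ 2) * J := by
        gcongr
        exact lintegral_mono_set (Set.preimage_mono (Metric.ball_subset_ball hry))
    _ ≤ ENNReal.ofReal (9 * k * (r ^ 2 * Real.pi)) * J := by
        refine mul_le_mul' (ENNReal.ofReal_le_ofReal ?_) le_rfl
        -- Since `4 k r² = y²`, the claim is `27 / 4 ≤ 9π / 4`; this fixes the constant `9`.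
        nlinarith [Real.pi_gt_three, sq_nonneg y]
    _ = 9 * k * J * volume (Metric.ball (z₀ : ℂ) r) := by
        rw [hV, ENNReal.ofReal_mul (by positivity), ENNReal.ofReal_mul (by positivity),
          ENNReal.ofReal_natCast, ENNReal.ofReal_ofNat]
        ring

/-! ### Comparison of integrals over compact sets with integrals over the quotient. -/

variable {Γ : Subgroup PSL(2, ℝ)} {k : ℕ}

/-- The integral of an invariant function over a compact set is bounded by a multiple of its
integral over the fundamental domain. -/
theorem exists_setLIntegral_le_fundamentalDomain [DiscreteTopology Γ] {L : Set ℍ}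
    (hL : IsCompact L) :
    ∃ N : ℕ, ∀ φ : ℍ → ℝ≥0∞, Measurable φ → (∀ (γ : Γ) (z : ℍ), φ (γ • z) = φ z) →
      ∫⁻ z in L, φ z ≤ N * ∫⁻ z in fundamentalDomain Γ, φ z := by
  have := countable_of_discrete Γ
  have hfin : Set.Finite {γ : Γ | ((γ • ·) '' L ∩ L).Nonempty} :=
    ProperlyDiscontinuousSMul.finite_disjoint_inter_image hL hL
  refine ⟨hfin.toFinset.card, fun φ hφ hinv => ?_⟩
  have hmeas : ∀ γ : Γ, MeasurableSet (γ • L) := fun γ =>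
    (hL.image (continuous_const_smul γ)).measurableSet
  -- If one translate `δ • L` contains `z`, then `γ ↦ δ⁻¹ * γ` injects the translates containing `z`
  -- into the finite set of elements moving `L` to meet itself.
  have hcount : ∀ z : ℍ, Set.encard {γ : Γ | z ∈ γ • L} ≤ hfin.toFinset.card := by
    intro z
    rcases Set.eq_empty_or_nonempty {γ : Γ | z ∈ γ • L} with h | ⟨δ, hδ⟩
    · simp [h]
    · rw [← Set.encard_coe_eq_coe_finsetCard, hfin.coe_toFinset]
      refine Set.encard_le_encard_of_injOn (f := fun γ => δ⁻¹ * γ) ?_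
        (mul_right_injective _).injOn
      intro γ hγ
      refine ⟨δ⁻¹ • z, ⟨γ⁻¹ • z, Set.mem_smul_set_iff_inv_smul_mem.mp hγ, ?_⟩,
        Set.mem_smul_set_iff_inv_smul_mem.mp hδ⟩
      simp [mul_smul]
  calc ∫⁻ z in L, φ z
      = ∑' γ : Γ, ∫⁻ z in γ • L ∩ fundamentalDomain Γ, φ (γ⁻¹ • z) :=
        (isFundamentalDomain Γ).setLIntegral_eq_tsum' φ L
    _ = ∑' γ : Γ, ∫⁻ z in fundamentalDomain Γ, (γ • L).indicator φ z := by
        refine tsum_congr fun γ => ?_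
        simp_rw [hinv]
        rw [lintegral_indicator (hmeas γ), Measure.restrict_restrict (hmeas γ)]
    _ = ∫⁻ z in fundamentalDomain Γ, ∑' γ : Γ, (γ • L).indicator φ z :=
        (lintegral_tsum fun γ => (hφ.indicator (hmeas γ)).aemeasurable).symm
    _ ≤ ∫⁻ z in fundamentalDomain Γ, hfin.toFinset.card * φ z := by
        refine lintegral_mono fun z => ?_
        have : ∀ γ : Γ, (γ • L).indicator φ z =
            {γ : Γ | z ∈ γ • L}.indicator (fun _ => φ z) γ := fun γ => by
          by_cases h : z ∈ γ • L <;> simp [h]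
        simp_rw [this]
        rw [← tsum_subtype, ENNReal.tsum_set_const]
        gcongr
        exact_mod_cast hcount z
    _ = _ := lintegral_const_mul _ hφ

/-! ### Orthonormal families and the extremal cusp form. -/

instance : (matrixGroup Γ).HasDetOne where
  det_eq := by
    rintro _ ⟨g, -, rfl⟩
    simp

theorem exists_cuspForm_eq_sum {ι : Type*} (f : ι → CuspForms Γ k) (a : ι → ℂ) (t : Finset ι) :
    ∃ g : CuspForms Γ k, ∀ z, g z = ∑ j ∈ t, a j * f j z := by
  refine ⟨∑ j ∈ t, a j • f j, fun z => ?_⟩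
  simp

theorem continuous_cuspForm (g : CuspForms Γ k) : Continuous g :=
  (CuspFormClass.holo g).continuous

theorem SquareIntegrable.integrableOn_mul [DiscreteTopology Γ] {f g : CuspForms Γ k}
    (hf : SquareIntegrable f) (hg : SquareIntegrable g) :
    IntegrableOn (fun z : ℍ => f z * conj (g z) * (z.im : ℂ) ^ (2 * k)) (fundamentalDomain Γ) := by
  refine Integrable.mono' (Integrable.add hf hg) ?_ (ae_of_all _ fun z => ?_)
  · have := continuous_cuspForm f
    have := continuous_cuspForm g
    exact Continuous.aestronglyMeasurable (by fun_prop)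
  · have : ‖(z.im : ℂ) ^ (2 * k)‖ = z.im ^ (2 * k) := by
      rw [norm_pow, Complex.norm_real, Real.norm_of_nonneg z.im_pos.le]
    simp only [norm_mul, RCLike.norm_conj, this, Pi.add_apply, ← add_mul]
    have := z.im_pos
    gcongr
    nlinarith [sq_nonneg (‖f z‖ - ‖g z‖), sq_nonneg (‖f z‖), sq_nonneg (‖g z‖)]

/-- Parseval for finite combinations: expand `g * conj g` and integrate termwise, so that only the
diagonal survives. -/
theorem IsOrthonormalBasis.lintegral_sq_norm_sum [DiscreteTopology Γ] {ι : Type*}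
    {f : ι → CuspForms Γ k} (hf : IsOrthonormalBasis f) (a : ι → ℂ) (t : Finset ι)
    {g : ℍ → ℂ} (hg : ∀ z, g z = ∑ j ∈ t, a j * f j z) :
    ∫⁻ z in fundamentalDomain Γ, ENNReal.ofReal (‖g z‖ ^ 2 * z.im ^ (2 * k)) =
      ENNReal.ofReal (∑ j ∈ t, ‖a j‖ ^ 2) := by
  classical
  have hint : ∀ i j, IntegrableOn (fun z : ℍ => a i * conj (a j) *
      (f i z * conj (f j z) * (z.im : ℂ) ^ (2 * k))) (fundamentalDomain Γ) := fun i j =>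
    ((hf.squareIntegrable i).integrableOn_mul (hf.squareIntegrable j)).const_mul _
  have hexp : (fun z : ℍ => ((‖g z‖ ^ 2 * z.im ^ (2 * k) : ℝ) : ℂ)) = fun z =>
      ∑ i ∈ t, ∑ j ∈ t, a i * conj (a j) * (f i z * conj (f j z) * (z.im : ℂ) ^ (2 * k)) := by
    ext1 z
    push_cast
    rw [← Complex.mul_conj', hg, map_sum, Finset.sum_mul_sum, Finset.sum_mul]
    refine Finset.sum_congr rfl fun i _ => ?_
    rw [Finset.sum_mul]
    refine Finset.sum_congr rfl fun j _ => ?_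
    rw [map_mul]
    ring
  have hintg : Integrable (fun z : ℍ => ((‖g z‖ ^ 2 * z.im ^ (2 * k) : ℝ) : ℂ))
      (volume.restrict (fundamentalDomain Γ)) := by
    rw [hexp]
    exact integrable_finsetSum _ fun i _ => integrable_finsetSum _ fun j _ => hint i j
  have hval : ∫ z in fundamentalDomain Γ, ((‖g z‖ ^ 2 * z.im ^ (2 * k) : ℝ) : ℂ) =
      ((∑ j ∈ t, ‖a j‖ ^ 2 : ℝ) : ℂ) := by
    rw [hexp, integral_finsetSum _ fun i _ => integrable_finsetSum _ fun j _ => hint i j]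
    push_cast
    refine Finset.sum_congr rfl fun i hi => ?_
    rw [integral_finsetSum _ fun j _ => hint i j, Finset.sum_eq_single i]
    · rw [integral_const_mul]
      change _ * peterssonInner (f i) (f i) = _
      rw [hf.inner_self, mul_one, Complex.mul_conj']
    · intro j _ hj
      rw [integral_const_mul]
      change _ * peterssonInner (f i) (f j) = _
      rw [hf.inner_of_ne i j hj.symm, mul_zero]
    · exact fun h => absurd hi h
  rw [integral_complex_ofReal, Complex.ofReal_inj] at hval
  rw [← hval, ofReal_integral_eq_lintegral_ofReal]
  · exact hintg.re
  · exact ae_of_all _ fun z => mul_nonneg (sq_nonneg _) (pow_nonneg z.im_pos.le _)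

theorem IsOrthonormalBasis.tsum_le [DiscreteTopology Γ] {ι : Type*}
    {f : ι → CuspForms Γ k} (hf : IsOrthonormalBasis f) (hk : 0 < k) {L : Set ℍ} {N : ℕ}
    (hN : ∀ φ : ℍ → ℝ≥0∞, Measurable φ → (∀ (γ : Γ) (z : ℍ), φ (γ • z) = φ z) →
      ∫⁻ z in L, φ z ≤ N * ∫⁻ z in fundamentalDomain Γ, φ z)
    {z : ℍ} (hz : ((↑) : ℍ → ℂ) ⁻¹' Metric.ball (z : ℂ) (z.im / 2) ⊆ L) :
    ∑' j, ENNReal.ofReal (‖f j z‖ ^ 2 * z.im ^ (2 * k)) ≤ 9 * N * k := by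
  rw [ENNReal.tsum_eq_iSup_sum]
  refine iSup_le fun t => ?_
  -- These coefficients give equality in the Cauchy–Schwarz inequality at `z`.
  obtain ⟨g, hg⟩ := exists_cuspForm_eq_sum f (fun j => conj (f j z)) t
  set s : ℝ := ∑ j ∈ t, ‖f j z‖ ^ 2 with hs
  have hs0 : 0 ≤ s := Finset.sum_nonneg fun j _ => sq_nonneg _
  have hgz : ‖g z‖ = s := by
    have : g z = (s : ℂ) := by
      rw [hg, hs]
      push_cast
      exact Finset.sum_congr rfl fun j _ => Complex.conj_mul' _
    rw [this, Complex.norm_real, Real.norm_of_nonneg hs0]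
  have hF : ∫⁻ z in fundamentalDomain Γ, ENNReal.ofReal (‖g z‖ ^ 2 * z.im ^ (2 * k)) =
      ENNReal.ofReal s := by
    rw [hf.lintegral_sq_norm_sum _ t hg]
    simp [hs]
  have hmeas : Measurable fun z : ℍ => ENNReal.ofReal (‖g z‖ ^ 2 * z.im ^ (2 * k)) := by
    have := continuous_cuspForm g
    have : Continuous fun z : ℍ => ‖g z‖ ^ 2 * z.im ^ (2 * k) := by fun_prop
    exact this.measurable.ennreal_ofReal
  have key : ENNReal.ofReal (s ^ 2 * z.im ^ (2 * k)) ≤ 9 * k * (N * ENNReal.ofReal s) := by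
    rw [← hF, ← hgz]
    refine (ofReal_sq_norm_mul_im_pow_le (mdifferentiable_iff.mp (CuspFormClass.holo g))
      z hk).trans ?_
    gcongr
    refine (lintegral_mono_set hz).trans (hN _ hmeas fun γ w => ?_)
    rw [sq_norm_mul_im_smul]
  rw [← ENNReal.ofReal_sum_of_nonneg
    fun j _ => mul_nonneg (sq_nonneg _) (pow_nonneg z.im_pos.le _), ← Finset.sum_mul, ← hs]
  rcases hs0.eq_or_lt with h0 | h0
  · simp [← h0]
  · refine (ENNReal.mul_le_mul_iff_right (ENNReal.ofReal_pos.mpr h0).ne'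
      ENNReal.ofReal_ne_top).mp ?_
    rw [← ENNReal.ofReal_mul hs0]
    calc _ = ENNReal.ofReal (s ^ 2 * z.im ^ (2 * k)) := by ring_nf
      _ ≤ _ := key
      _ = _ := by ring

/-! ### From local bounds to compact subsets of the quotient. -/

/-- Around every point of `ℍ` there is a bound for the sums of squares which is uniform in the
point and linear in the weight. -/
theorem exists_nhds_tsum_le (Γ : Subgroup PSL(2, ℝ)) [DiscreteTopology Γ] (p : ℍ) :
    ∃ N : ℕ, ∃ U : Set ℍ, IsOpen U ∧ p ∈ U ∧ ∀ z ∈ U, ∀ k : ℕ, 0 < k →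
      ∀ (ι : Type*) (f : ι → CuspForms Γ k), IsOrthonormalBasis f →
        ∑' j, ENNReal.ofReal (‖f j z‖ ^ 2 * z.im ^ (2 * k)) ≤ 9 * N * k := by
  -- If `z` is within `p.im / 4` of `p`, then `z.im / 2 < 5 / 8 * p.im`, so the disc about `z` lies
  -- within `1 / 4 + 5 / 8 = 7 / 8` of `p`, in units of `p.im`. As `7 / 8 < 1`, the closed disc
  -- stays inside `ℍ`.
  have hL : IsCompact (((↑) : ℍ → ℂ) ⁻¹' Metric.closedBall (p : ℂ) (7 / 8 * p.im)) := by
    rw [isOpenEmbedding_coe.isEmbedding.isCompact_iff, Set.image_preimage_eq_of_subset]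
    · exact isCompact_closedBall _ _
    · intro z hz
      have h1 := (Complex.abs_im_le_norm (z - p)).trans (mem_closedBall_iff_norm.mp hz)
      rw [Complex.sub_im, coe_im] at h1
      exact ⟨⟨z, by linarith [(abs_le.mp h1).1, p.im_pos]⟩, rfl⟩
  obtain ⟨N, hN⟩ := exists_setLIntegral_le_fundamentalDomain (Γ := Γ) hL
  refine ⟨N, ((↑) : ℍ → ℂ) ⁻¹' Metric.ball (p : ℂ) (p.im / 4),
    Metric.isOpen_ball.preimage continuous_coe, by simp [p.im_pos],
    fun z hz k hk ι f hf => hf.tsum_le hk hN (Set.preimage_mono ?_)⟩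
  have hz' : dist (z : ℂ) p < p.im / 4 := hz
  have h1 := (Complex.abs_im_le_norm ((z : ℂ) - p)).trans_lt (mem_ball_iff_norm.mp hz)
  rw [Complex.sub_im, coe_im, coe_im] at h1
  refine Metric.ball_subset_closedBall.trans (Metric.closedBall_subset_closedBall' ?_)
  linarith [(abs_lt.mp h1).2]

end Fuchsian

theorem theorem4p2 (Γ : Subgroup PSL(2, ℝ)) [DiscreteTopology Γ]
    (K : Set (Fuchsian.QuotientSpace Γ)) (hK : IsCompact K) :
    ∃ C : ℝ≥0, ∀ k : ℕ, 0 < k → ∀ (ι : Type*) (f : ι → Fuchsian.CuspForms Γ k),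
      Fuchsian.IsOrthonormalBasis f → (⨆ z ∈ K, Fuchsian.sumSq f z) ≤ C * k := by
  choose N U hUo hpU hU using Fuchsian.exists_nhds_tsum_le Γ
  obtain ⟨t, ht⟩ := hK.elim_finite_subcover
    (fun p : ℍ => (Quotient.mk (MulAction.orbitRel Γ ℍ)) '' U p)
    (fun p => isOpenMap_quotient_mk'_mul _ (hUo p)) (by
      rintro ⟨p⟩ -
      exact Set.mem_iUnion.mpr ⟨p, p, hpU p, rfl⟩)
  -- The sum dominates each of the finitely many local constants.
  refine ⟨∑ p ∈ t, 9 * (N p : ℝ≥0), fun k hk ι f hf => iSup₂_le fun x hx => ?_⟩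
  obtain ⟨p, hp, z, hz, rfl⟩ := Set.mem_iUnion₂.mp (ht hx)
  refine (hU p z hz k hk ι f hf).trans ?_
  gcongr
  have : 9 * (N p : ℝ≥0) ≤ ∑ p ∈ t, 9 * (N p : ℝ≥0) :=
    Finset.single_le_sum (f := fun p => 9 * (N p : ℝ≥0)) (fun _ _ => zero_le) hp
  exact_mod_cast ENNReal.coe_le_coe.mpr this
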